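/- For $p\in(0,1)$ let $\xi_1,\dots,\xi_n$ be i.i.d. random variables such that \[ \xi_1=\sqrt{\tfrac{1-p}{p}}\ \text{ with probability } p,\qquad \xi_1=-\sqrt{\tfrac{p}{1-p}}\ \text{ with probability } 1-p \] (so $\mathbb E\,\xi_1=0$ and $\mathbb E\,\xi_1^2=1$); in the degenerate cases $p=0$ and $p=1$, where one of the two values is undefined but has probability $0$, this means $\xi_j=0$ almost surely. Then for every $p\in[0,1]$ \[ \sup_{n\ge 1}\ \sup_{\substack{a\in\mathbb R^n\\ a_1^2+\dots+a_n^2=1}}\ \mathbb E\Big|\sum_{j=1}^n a_j\xi_j\Big| \ \le\ 1-\frac{\min\{4p^3(1-p)^3,\ (2p-1)^4p(1-p)\}}{45-3(p(1-p))^3}. \] -/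

import Mathlib

open MeasureTheory ProbabilityTheory

/-- The law of a normalized biased Bernoulli variable with parameter `p`: the value
`√((1 - p) / p)` is taken with probability `p` and the value `-√(p / (1 - p))` with probability
`1 - p`. For `p = 0` and for `p = 1` the atom whose position is not defined has mass zero, and the
law is the point mass at `0`. -/
noncomputable def biasedBernoulliLaw (p : ℝ) : Measure ℝ :=
  ENNReal.ofReal p • Measure.dirac (Real.sqrt ((1 - p) / p))
    + ENNReal.ofReal (1 - p) • Measure.dirac (-Real.sqrt (p / (1 - p)))

/-! Let `S` be the normalized sum, so E S² = 1. If |S| were nearly 1 in mean, S² would be nearly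
constant; a fourth moment strictly above 1 prevents this, and a sixth-moment bound makes it
quantitative (`integral_abs_le_of_moments`). With t = p(1-p) and K = 1/t ≥ 4, induction on the
number of summands (`moments_sum_of_iIndepFun`) gives E S⁴ ≥ min(3, K - 3) and E S⁶ ≤ (25/12)K²,
whatever the weights. The stated bound then follows by comparing functions of t. -/

/-- Monomials in two almost surely bounded random variables are integrable. -/
lemma integrable_pow_mul_pow_of_ae_bounded {Ω : Type*} [MeasurableSpace Ω] {μ : Measure Ω}
    [IsFiniteMeasure μ] {X Y : Ω → ℝ} (hX : AEMeasurable X μ) (hY : AEMeasurable Y μ)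
    {B C : ℝ} (hB : ∀ᵐ ω ∂μ, |X ω| ≤ B) (hC : ∀ᵐ ω ∂μ, |Y ω| ≤ C) (k l : ℕ) :
    Integrable (fun ω => X ω ^ k * Y ω ^ l) μ := by
  refine Integrable.of_bound
    ((hX.pow_const k).mul (hY.pow_const l)).aestronglyMeasurable (B ^ k * C ^ l) ?_
  filter_upwards [hB, hC] with ω h1 h2
  rw [Real.norm_eq_abs, abs_mul, abs_pow, abs_pow]
  have hB0 : 0 ≤ B := (abs_nonneg _).trans h1
  gcongr

lemma integrable_pow_of_ae_bounded {Ω : Type*} [MeasurableSpace Ω] {μ : Measure Ω}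
    [IsFiniteMeasure μ] {X : Ω → ℝ} (hX : AEMeasurable X μ)
    {B : ℝ} (hB : ∀ᵐ ω ∂μ, |X ω| ≤ B) (k : ℕ) : Integrable (fun ω => X ω ^ k) μ := by
  simpa using integrable_pow_mul_pow_of_ae_bounded hX hX hB hB k 0

/-! ### Moments of independent sums -/

/-- Moments of order two, four and six of the sum of two independent bounded centred variables. -/
lemma moments_add_of_indepFun {Ω : Type*} [MeasurableSpace Ω] {μ : Measure Ω}
    [IsProbabilityMeasure μ] {S X : Ω → ℝ} (hS : AEMeasurable S μ) (hX : AEMeasurable X μ)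
    {B C : ℝ} (hB : ∀ᵐ ω ∂μ, |S ω| ≤ B) (hC : ∀ᵐ ω ∂μ, |X ω| ≤ C) (hSX : IndepFun S X μ)
    (hS0 : ∫ ω, S ω ∂μ = 0) (hX0 : ∫ ω, X ω ∂μ = 0) :
    ∫ ω, (S ω + X ω) ^ 2 ∂μ = ∫ ω, S ω ^ 2 ∂μ + ∫ ω, X ω ^ 2 ∂μ ∧
    ∫ ω, (S ω + X ω) ^ 4 ∂μ = ∫ ω, S ω ^ 4 ∂μ
      + 6 * ((∫ ω, S ω ^ 2 ∂μ) * ∫ ω, X ω ^ 2 ∂μ) + ∫ ω, X ω ^ 4 ∂μ ∧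
    ∫ ω, (S ω + X ω) ^ 6 ∂μ ≤ ∫ ω, S ω ^ 6 ∂μ
      + 25 * ((∫ ω, S ω ^ 4 ∂μ) * ∫ ω, X ω ^ 2 ∂μ)
      + 25 * ((∫ ω, S ω ^ 2 ∂μ) * ∫ ω, X ω ^ 4 ∂μ) + ∫ ω, X ω ^ 6 ∂μ := by
  have I := integrable_pow_mul_pow_of_ae_bounded hS hX hB hC
  have IS := integrable_pow_of_ae_bounded hS hB
  have IX := integrable_pow_of_ae_bounded hX hC
  have E : ∀ k l : ℕ, ∫ ω, S ω ^ k * X ω ^ l ∂μ = (∫ ω, S ω ^ k ∂μ) * ∫ ω, X ω ^ l ∂μ :=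
    fun k l => hSX.integral_fun_comp_mul_comp hS hX (f := fun x => x ^ k) (g := fun x => x ^ l)
      (by fun_prop) (by fun_prop)
  have E1 : ∀ k : ℕ, ∫ ω, S ω ^ k * X ω ^ 1 ∂μ = 0 := fun k => by rw [E]; simp [hX0]
  have E2 : ∀ k : ℕ, ∫ ω, S ω ^ 1 * X ω ^ k ∂μ = 0 := fun k => by rw [E]; simp [hS0]
  refine ⟨?_, ?_, ?_⟩
  · have h : ∀ ω, (S ω + X ω) ^ 2 = S ω ^ 2 + 2 * (S ω ^ 1 * X ω ^ 1) + X ω ^ 2 :=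
      fun ω => by ring
    have i1 := (IS 2).add ((I 1 1).const_mul 2)
    simp only [Pi.add_def] at i1
    simp_rw [h]
    rw [integral_add i1 (IX 2),
      integral_add (IS 2) ((I 1 1).const_mul 2), integral_const_mul, E1]
    ring
  · have h : ∀ ω, (S ω + X ω) ^ 4 = S ω ^ 4 + 4 * (S ω ^ 3 * X ω ^ 1)
        + 6 * (S ω ^ 2 * X ω ^ 2) + 4 * (S ω ^ 1 * X ω ^ 3) + X ω ^ 4 := fun ω => by ring
    have i1 := (IS 4).add ((I 3 1).const_mul 4)
    have i2 := i1.add ((I 2 2).const_mul 6)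
    have i3 := i2.add ((I 1 3).const_mul 4)
    simp only [Pi.add_def] at i1 i2 i3
    simp_rw [h]
    rw [integral_add i3 (IX 4), integral_add i2 ((I 1 3).const_mul 4),
      integral_add i1 ((I 2 2).const_mul 6), integral_add (IS 4) ((I 3 1).const_mul 4),
      integral_const_mul, integral_const_mul, integral_const_mul, E1, E2, E 2 2]
    ring
  · have i1 := (IS 6).add ((I 5 1).const_mul 6)
    have i2 := i1.add ((I 4 2).const_mul 25)
    have i3 := i2.add ((I 2 4).const_mul 25)
    have i4 := i3.add ((I 1 5).const_mul 6)
    simp only [Pi.add_def] at i1 i2 i3 i4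
    calc ∫ ω, (S ω + X ω) ^ 6 ∂μ
        ≤ ∫ ω, (S ω ^ 6 + 6 * (S ω ^ 5 * X ω ^ 1) + 25 * (S ω ^ 4 * X ω ^ 2)
          + 25 * (S ω ^ 2 * X ω ^ 4) + 6 * (S ω ^ 1 * X ω ^ 5) + X ω ^ 6) ∂μ := by
          refine integral_mono
            (integrable_pow_of_ae_bounded (B := B + C) (hS.add hX) ?_ 6) (i4.add (IX 6)) ?_
          · filter_upwards [hB, hC] with ω h1 h2
            exact (abs_add_le _ _).trans (add_le_add h1 h2)
          · intro ω
            beta_reduce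
            -- Third moments need not vanish, so 20S³X³ is bounded by 10(S⁴X² + S²X⁴); this raises
            -- both coefficients 15 to 25.
            nlinarith [mul_nonneg (sq_nonneg (S ω * X ω)) (sq_nonneg (S ω - X ω))]
      _ = _ := by
          rw [integral_add i4 (IX 6), integral_add i3 ((I 1 5).const_mul 6),
            integral_add i2 ((I 2 4).const_mul 25), integral_add i1 ((I 4 2).const_mul 25),
            integral_add (IS 6) ((I 5 1).const_mul 6), integral_const_mul, integral_const_mul,
            integral_const_mul, integral_const_mul, E1, E2, E 4 2, E 2 4]
          ring

/-- Moment bounds for sums of independent bounded centred variables whose even moments of order at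
most six are controlled by a common kurtosis parameter `K`. -/
lemma moments_sum_of_iIndepFun {Ω ι : Type*} [MeasurableSpace Ω] {μ : Measure Ω}
    [IsProbabilityMeasure μ] {X : ι → Ω → ℝ} (hX : ∀ i, AEMeasurable (X i) μ)
    (hind : iIndepFun X μ) {B : ι → ℝ} (hB : ∀ i, ∀ᵐ ω ∂μ, |X i ω| ≤ B i)
    {a : ι → ℝ} {K c : ℝ} (hK : 4 ≤ K) (hc3 : c ≤ 3) (hcK : c ≤ K - 3)
    (h1 : ∀ i, ∫ ω, X i ω ∂μ = 0) (h2 : ∀ i, ∫ ω, X i ω ^ 2 ∂μ = a i ^ 2)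
    (h4 : ∀ i, ∫ ω, X i ω ^ 4 ∂μ = (K - 3) * a i ^ 4)
    (h6 : ∀ i, ∫ ω, X i ω ^ 6 ∂μ ≤ K ^ 2 * a i ^ 6) (s : Finset ι) :
    AEMeasurable (fun ω => ∑ i ∈ s, X i ω) μ ∧
    (∀ᵐ ω ∂μ, |∑ i ∈ s, X i ω| ≤ ∑ i ∈ s, B i) ∧
    ∫ ω, ∑ i ∈ s, X i ω ∂μ = 0 ∧
    ∫ ω, (∑ i ∈ s, X i ω) ^ 2 ∂μ = ∑ i ∈ s, a i ^ 2 ∧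
    c * (∑ i ∈ s, a i ^ 2) ^ 2 ≤ ∫ ω, (∑ i ∈ s, X i ω) ^ 4 ∂μ ∧
    ∫ ω, (∑ i ∈ s, X i ω) ^ 4 ∂μ ≤ K * (∑ i ∈ s, a i ^ 2) ^ 2 ∧
    ∫ ω, (∑ i ∈ s, X i ω) ^ 6 ∂μ ≤ 25 / 12 * K ^ 2 * (∑ i ∈ s, a i ^ 2) ^ 3 := by
  classical
  induction s using Finset.induction_on with
  | empty => simp
  | insert j s hj ih =>
    obtain ⟨m, b, e1, e2, e4l, e4u, e6⟩ := ih
    have hi : IndepFun (fun ω => ∑ i ∈ s, X i ω) (X j) μ := by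
      have h := hind.indepFun_finsetSum_of_notMem₀ hX hj
      have he : (∑ i ∈ s, X i) = fun ω => ∑ i ∈ s, X i ω := by ext ω; simp
      rwa [he] at h
    obtain ⟨f2, f4, f6⟩ := moments_add_of_indepFun m (hX j) b (hB j) hi e1 (h1 j)
    have hv : 0 ≤ ∑ i ∈ s, a i ^ 2 := Finset.sum_nonneg fun i _ => sq_nonneg _
    simp only [Finset.sum_insert hj, add_comm (X j _), add_comm (B j), add_comm (a j ^ 2)]
    set v := ∑ i ∈ s, a i ^ 2
    have ha : 0 ≤ a j ^ 2 := sq_nonneg _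
    rw [e2, h2 j] at f2
    rw [e2, h2 j, h4 j] at f4
    rw [e2, h2 j, h4 j] at f6
    have h6j := h6 j
    rw [show a j ^ 4 = (a j ^ 2) ^ 2 by ring] at f4 f6
    rw [show a j ^ 6 = (a j ^ 2) ^ 3 by ring] at h6j
    set w := a j ^ 2
    have hvw : 0 ≤ v * w := mul_nonneg hv ha
    refine ⟨m.add (hX j), ?_, ?_, f2, ?_, ?_, ?_⟩
    · filter_upwards [b, hB j] with ω g1 g2
      exact (abs_add_le _ _).trans (add_le_add g1 g2)
    · rw [integral_add _ _, e1, h1 j, add_zero]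
      · simpa using integrable_pow_of_ae_bounded m b 1
      · simpa using integrable_pow_of_ae_bounded (hX j) (hB j) 1
    · rw [f4]
      nlinarith [mul_nonneg (sub_nonneg.2 hc3) hvw, mul_nonneg (sub_nonneg.2 hcK) (sq_nonneg w)]
    · rw [f4]
      nlinarith [mul_nonneg (sub_nonneg.2 hK) hvw, sq_nonneg w]
    · have g1 : (∫ ω, (∑ i ∈ s, X i ω) ^ 4 ∂μ) * w ≤ K * v ^ 2 * w := by gcongr
      -- The v²w coefficient of (25/12)K²(v + w)³ is (25/4)K²; it dominates 25K exactly because K ≥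
      -- 4.
      have g2 : 25 * (K * (v ^ 2 * w)) ≤ 25 / 4 * K ^ 2 * (v ^ 2 * w) := by
        have : 0 ≤ v ^ 2 * w := by positivity
        have h5 : 25 * K ≤ 25 / 4 * K ^ 2 := by nlinarith
        nlinarith [mul_le_mul_of_nonneg_right h5 this]
      have g3 : 25 * (v * ((K - 3) * w ^ 2)) ≤ 25 / 4 * K ^ 2 * (v * w ^ 2) := by
        have : 0 ≤ v * w ^ 2 := by positivity
        have h5 : 25 * (K - 3) ≤ 25 / 4 * K ^ 2 := by nlinarith
        nlinarith [mul_le_mul_of_nonneg_right h5 this]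
      have g4 : 0 ≤ K ^ 2 * w ^ 3 := by positivity
      nlinarith

/-! ### From moments to the first absolute moment -/

/-- A random variable with unit second moment has first absolute moment bounded away from one, in
terms of its fourth and sixth moments. -/
lemma integral_abs_le_of_moments {Ω : Type*} [MeasurableSpace Ω] {μ : Measure Ω}
    [IsProbabilityMeasure μ] {S : Ω → ℝ} (hS : AEMeasurable S μ)
    {B : ℝ} (hB : ∀ᵐ ω ∂μ, |S ω| ≤ B) {m D : ℝ} (hm : 0 ≤ m) (hD : 0 < D)
    (h2 : ∫ ω, S ω ^ 2 ∂μ = 1) (h4 : 1 + m ≤ ∫ ω, S ω ^ 4 ∂μ) (h6 : ∫ ω, S ω ^ 6 ∂μ ≤ D) :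
    ∫ ω, |S ω| ∂μ ≤ 1 - m ^ 2 / (4 * D) := by
  have IS := integrable_pow_of_ae_bounded hS hB
  have hI : Integrable (fun ω => |S ω|) μ := by simpa using (IS 1).abs
  -- This value minimizes -lm + l²D.
  obtain ⟨l, hl⟩ : ∃ l, l = m / (2 * D) := ⟨_, rfl⟩
  have hl0 : 0 ≤ l := by rw [hl]; positivity
  -- With x = |S|, the right side is (1 + x²)/2 - l(x² - 1)² + l²(x² - 1)²(x² + 1); subtracting x
  -- leaves a sum of squares.
  have key : ∀ ω, |S ω| ≤ (1 / 2 - l + l ^ 2) + (1 / 2 + 2 * l - l ^ 2) * S ω ^ 2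
      + (-l - l ^ 2) * S ω ^ 4 + l ^ 2 * S ω ^ 6 := by
    intro ω
    have hx := sq_abs (S ω)
    rw [show S ω ^ 4 = (S ω ^ 2) ^ 2 by ring, show S ω ^ 6 = (S ω ^ 2) ^ 3 by ring, ← hx]
    generalize |S ω| = x
    have e : (1 / 2 - l + l ^ 2) + (1 / 2 + 2 * l - l ^ 2) * x ^ 2
      + (-l - l ^ 2) * (x ^ 2) ^ 2 + l ^ 2 * (x ^ 2) ^ 3 - x
      = ((x - 1) - l * ((x ^ 2 - 1) * (x + 1))) ^ 2 / 2
        + l ^ 2 * ((x ^ 2 - 1) * (x - 1)) ^ 2 / 2 := by ring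
    have : 0 ≤ ((x - 1) - l * ((x ^ 2 - 1) * (x + 1))) ^ 2 / 2
        + l ^ 2 * ((x ^ 2 - 1) * (x - 1)) ^ 2 / 2 := by positivity
    linarith
  have i1 := (integrable_const (μ := μ) (1 / 2 - l + l ^ 2)).add
    ((IS 2).const_mul (1 / 2 + 2 * l - l ^ 2))
  have i2 := i1.add ((IS 4).const_mul (-l - l ^ 2))
  have i3 := i2.add ((IS 6).const_mul (l ^ 2))
  simp only [Pi.add_def] at i1 i2 i3
  refine (integral_mono hI i3 key).trans ?_
  rw [integral_add i2 ((IS 6).const_mul (l ^ 2)), integral_add i1 ((IS 4).const_mul (-l - l ^ 2)),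
    integral_add (integrable_const _) ((IS 2).const_mul (1 / 2 + 2 * l - l ^ 2)),
    integral_const_mul, integral_const_mul, integral_const_mul, h2, integral_const]
  simp only [probReal_univ, smul_eq_mul]
  have g : m ^ 2 / (4 * D) = l * m - l ^ 2 * D := by rw [hl]; field_simp; ring
  rw [g]
  nlinarith [mul_le_mul_of_nonneg_left h4 (add_nonneg hl0 (sq_nonneg l)),
    mul_le_mul_of_nonneg_left h6 (sq_nonneg l), mul_nonneg hm (sq_nonneg l)]

/-! ### The biased Bernoulli law -/

lemma integral_biasedBernoulliLaw {p : ℝ} (hp : p ∈ Set.Icc (0 : ℝ) 1) (f : ℝ → ℝ) :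
    ∫ x, f x ∂(biasedBernoulliLaw p)
      = p * f (Real.sqrt ((1 - p) / p)) + (1 - p) * f (-Real.sqrt (p / (1 - p))) := by
  have h : ∀ a : ℝ, Integrable f (Measure.dirac a) := fun a => integrable_dirac (by simp)
  rw [biasedBernoulliLaw, integral_add_measure ((h _).smul_measure (by simp))
    ((h _).smul_measure (by simp)), integral_smul_measure, integral_smul_measure,
    integral_dirac, integral_dirac, ENNReal.toReal_ofReal hp.1,
    ENNReal.toReal_ofReal (by linarith [hp.2])]
  simp

lemma ae_biasedBernoulliLaw {p : ℝ} {q : ℝ → Prop}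
    (h1 : 0 < p → q (Real.sqrt ((1 - p) / p)))
    (h2 : p < 1 → q (-Real.sqrt (p / (1 - p)))) : ∀ᵐ x ∂(biasedBernoulliLaw p), q x := by
  rw [biasedBernoulliLaw, ae_add_measure_iff]
  constructor
  · rcases lt_or_ge 0 p with h | h
    · exact Measure.ae_smul_measure (by simpa [ae_dirac_eq] using h1 h) _
    · simp [ENNReal.ofReal_of_nonpos h]
  · rcases lt_or_ge p 1 with h | h
    · exact Measure.ae_smul_measure (by simpa [ae_dirac_eq] using h2 h) _
    · simp [ENNReal.ofReal_of_nonpos (sub_nonpos.2 h)]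

/-- The even moments up to order six of the biased Bernoulli law, and its mean. -/
lemma moments_biasedBernoulliLaw {p : ℝ} (h0 : 0 < p) (h1 : p < 1) :
    ∫ x, x ∂(biasedBernoulliLaw p) = 0 ∧
    ∫ x, x ^ 2 ∂(biasedBernoulliLaw p) = 1 ∧
    ∫ x, x ^ 4 ∂(biasedBernoulliLaw p) = (p * (1 - p))⁻¹ - 3 ∧
    ∫ x, x ^ 6 ∂(biasedBernoulliLaw p) ≤ (p * (1 - p))⁻¹ ^ 2 := by
  have hq : 0 < 1 - p := by linarith
  have hp : p ∈ Set.Icc (0 : ℝ) 1 := ⟨h0.le, h1.le⟩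
  rw [integral_biasedBernoulliLaw hp, integral_biasedBernoulliLaw hp,
    integral_biasedBernoulliLaw hp, integral_biasedBernoulliLaw hp]
  set u := Real.sqrt ((1 - p) / p) with hu
  set w := Real.sqrt (p / (1 - p)) with hw
  have hu2 : u ^ 2 = (1 - p) / p := Real.sq_sqrt (by positivity)
  have hw2 : w ^ 2 = p / (1 - p) := Real.sq_sqrt (by positivity)
  have huw : u * w = 1 := by
    rw [hu, hw, ← Real.sqrt_mul (by positivity)]
    rw [div_mul_div_comm, mul_comm, div_self (by positivity), Real.sqrt_one]
  have e4 : ∀ x : ℝ, x ^ 4 = (x ^ 2) ^ 2 := fun x => by ring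
  have e6 : ∀ x : ℝ, x ^ 6 = (x ^ 2) ^ 3 := fun x => by ring
  refine ⟨?_, ?_, ?_, ?_⟩
  · have : p * u ^ 2 * w = (1 - p) * w := by rw [hu2]; field_simp
    linear_combination this - p * u * huw
  · rw [neg_sq, hu2, hw2]; field_simp; ring
  · rw [e4, e4, neg_sq, hu2, hw2]; field_simp; ring
  · rw [e6, e6, neg_sq, hu2, hw2]
    have : p * ((1 - p) / p) ^ 3 + (1 - p) * (p / (1 - p)) ^ 3
        = ((1 - p) ^ 5 + p ^ 5) * (p * (1 - p))⁻¹ ^ 2 := by field_simp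
    rw [this]
    have h5 : (1 - p) ^ 5 + p ^ 5 ≤ 1 := by
      have a1 : (1 - p) ^ 5 ≤ 1 - p := pow_le_of_le_one hq.le (by linarith) (by norm_num)
      have a2 : p ^ 5 ≤ p := pow_le_of_le_one h0.le h1.le (by norm_num)
      linarith
    exact mul_le_of_le_one_left (by positivity) h5

/-- The right side is (3/25)(mt)², where either m = 2 or mt = 1 - 4t; each case is matched with one
term of the minimum on the left, with room to spare. -/
lemma min_div_le_of_pos {t : ℝ} (ht0 : 0 < t) (ht : t ≤ 1 / 4) :
    min (4 * t ^ 3) ((1 - 4 * t) ^ 2 * t) / (45 - 3 * t ^ 3)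
      ≤ (min 3 (t⁻¹ - 3) - 1) ^ 2 / (4 * (25 / 12 * t⁻¹ ^ 2)) := by
  have ht3 : t ^ 3 ≤ 1 := pow_le_one₀ ht0.le (by linarith)
  have hden : 0 < 45 - 3 * t ^ 3 := by linarith
  have hr : ∀ m : ℝ, m ^ 2 / (4 * (25 / 12 * t⁻¹ ^ 2)) = 3 / 25 * (m * t) ^ 2 := by
    intro m; field_simp; ring
  rw [hr, div_le_iff₀ hden]
  rcases min_cases 3 (t⁻¹ - 3) with ⟨h, -⟩ | ⟨h, -⟩ <;> rw [h]
  · refine (min_le_left _ _).trans ?_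
    nlinarith [pow_pos ht0 2, pow_pos ht0 3]
  · refine (min_le_right _ _).trans ?_
    have : (t⁻¹ - 3 - 1) * t = 1 - 4 * t := by field_simp; ring
    rw [this]
    nlinarith [mul_nonneg (sq_nonneg (1 - 4 * t)) (show (0:ℝ) ≤ 1 / 4 - t by linarith),
      mul_nonneg (sq_nonneg (1 - 4 * t)) (sub_nonneg.2 ht3), sq_nonneg (1 - 4 * t)]

lemma integrable_abs_sum_biasedBernoulli {p : ℝ} {Ω ι : Type*} [Fintype ι] [MeasurableSpace Ω]
    {μ : Measure Ω} [IsProbabilityMeasure μ] {ξ : ι → Ω → ℝ}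
    (hlaw : ∀ j, HasLaw (ξ j) (biasedBernoulliLaw p) μ) (a : ι → ℝ) :
    Integrable (fun ω => |∑ j, a j * ξ j ω|) μ := by
  refine (integrable_finsetSum _ fun j _ => Integrable.const_mul ?_ _).abs
  have h : ∀ᵐ x ∂(biasedBernoulliLaw p),
      ‖x‖ ≤ max |Real.sqrt ((1 - p) / p)| |-Real.sqrt (p / (1 - p))| :=
    ae_biasedBernoulliLaw (fun _ => le_max_left _ _) (fun _ => le_max_right _ _)
  exact Integrable.of_bound (hlaw j).aemeasurable.aestronglyMeasurable _
    (((hlaw j).ae_iff (by fun_prop)).2 h)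

/-- The bound on the first absolute moment of a normalized weighted sum. -/
lemma integral_abs_sum_biasedBernoulli_le {p : ℝ} (hp : p ∈ Set.Icc (0 : ℝ) 1)
    {Ω ι : Type*} [Fintype ι] [MeasurableSpace Ω]
    {μ : Measure Ω} [IsProbabilityMeasure μ] {ξ : ι → Ω → ℝ}
    (hlaw : ∀ j, HasLaw (ξ j) (biasedBernoulliLaw p) μ) (hind : iIndepFun ξ μ)
    {a : ι → ℝ} (ha : ∑ j, a j ^ 2 = 1) :
    ∫ ω, |∑ j, a j * ξ j ω| ∂μ ≤
      1 - min (4 * p ^ 3 * (1 - p) ^ 3) ((2 * p - 1) ^ 4 * p * (1 - p))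
        / (45 - 3 * (p * (1 - p)) ^ 3) := by
  by_cases hd : p = 0 ∨ p = 1
  · have hz : ∀ j, ∀ᵐ ω ∂μ, ξ j ω = 0 := fun j => by
      refine ((hlaw j).ae_iff (p := fun x => x = 0) (by fun_prop)).2 ?_
      -- When p is 0 or 1, the only atom with positive mass lies at 0.
      apply ae_biasedBernoulliLaw <;> rcases hd with rfl | rfl <;> simp
    have hzz : (fun ω => |∑ j, a j * ξ j ω|) =ᵐ[μ] fun _ => 0 := by
      filter_upwards [ae_all_iff.2 hz] with ω h
      simp [h]
    rw [integral_congr_ae hzz]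
    rcases hd with rfl | rfl <;> simp
  push Not at hd
  have h0 : 0 < p := lt_of_le_of_ne hp.1 (Ne.symm hd.1)
  have h1 : p < 1 := lt_of_le_of_ne hp.2 hd.2
  have ht0 : 0 < p * (1 - p) := mul_pos h0 (by linarith)
  have ht : p * (1 - p) ≤ 1 / 4 := by nlinarith [sq_nonneg (2 * p - 1)]
  obtain ⟨m1, m2, m4, m6⟩ := moments_biasedBernoulliLaw h0 h1
  rw [show 4 * p ^ 3 * (1 - p) ^ 3 = 4 * (p * (1 - p)) ^ 3 by ring,
    show (2 * p - 1) ^ 4 * p * (1 - p) = (1 - 4 * (p * (1 - p))) ^ 2 * (p * (1 - p)) by ring]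
  set t := p * (1 - p)
  have hK : 4 ≤ t⁻¹ := by
    rw [le_inv_comm₀ (by norm_num) ht0]; linarith
  obtain ⟨C, hC⟩ : ∃ C, ∀ᵐ x ∂(biasedBernoulliLaw p), |x| ≤ C :=
    ⟨_, ae_biasedBernoulliLaw (fun _ => le_max_left |Real.sqrt ((1 - p) / p)|
      |-Real.sqrt (p / (1 - p))|) (fun _ => le_max_right _ _)⟩
  have hmom : ∀ j (k : ℕ), ∫ ω, (a j * ξ j ω) ^ k ∂μ
      = a j ^ k * ∫ x, x ^ k ∂(biasedBernoulliLaw p) := by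
    intro j k
    simp_rw [mul_pow]
    rw [integral_const_mul, ← (hlaw j).integral_comp (f := fun x => x ^ k) (by fun_prop)]
    rfl
  have hb : ∀ j, ∀ᵐ ω ∂μ, |a j * ξ j ω| ≤ |a j| * C := by
    intro j
    filter_upwards [((hlaw j).ae_iff (by fun_prop)).2 hC] with ω h
    rw [abs_mul]
    gcongr
  obtain ⟨n, b, -, e2, e4, -, e6⟩ := moments_sum_of_iIndepFun
    (X := fun j ω => a j * ξ j ω) (fun j => (hlaw j).aemeasurable.const_mul _)
    (hind.comp (fun j x => a j * x) (fun j => by fun_prop)) hb hK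
    (min_le_left 3 (t⁻¹ - 3)) (min_le_right _ _) (a := a)
    (fun j => by simpa [m1] using hmom j 1) (fun j => by rw [hmom, m2, mul_one])
    (fun j => by rw [hmom, m4, mul_comm])
    (fun j => by
      rw [hmom, mul_comm]
      exact mul_le_mul_of_nonneg_right m6 (by positivity)) Finset.univ
  rw [ha] at e2 e4 e6
  -- K ≥ 4 gives K - 3 ≥ 1.
  have hm : 0 ≤ min 3 (t⁻¹ - 3) - 1 :=
    sub_nonneg.2 (le_min (by norm_num) (by linarith))
  refine (integral_abs_le_of_moments n b hm (D := 25 / 12 * t⁻¹ ^ 2) (by positivity) e2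
    (by linarith) (by linarith)).trans ?_
  linarith [min_div_le_of_pos ht0 ht]

theorem mainTheorem2 (p : ℝ) (hp : p ∈ Set.Icc (0 : ℝ) 1)
    {Ω : ℕ → Type*} [∀ n, MeasurableSpace (Ω n)]
    (P : ∀ n, Measure (Ω n)) [∀ n, IsProbabilityMeasure (P n)]
    (ξ : ∀ n, Fin n → Ω n → ℝ)
    (hlaw : ∀ n j, HasLaw (ξ n j) (biasedBernoulliLaw p) (P n))
    (hindep : ∀ n, iIndepFun (ξ n) (P n)) :
    (∀ n : ℕ, 1 ≤ n → ∀ a : Fin n → ℝ, ∑ j, a j ^ 2 = 1 →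
      Integrable (fun ω => |∑ j, a j * ξ n j ω|) (P n)) ∧
    BddAbove {x : ℝ | ∃ n : ℕ, 1 ≤ n ∧ ∃ a : Fin n → ℝ, ∑ j, a j ^ 2 = 1 ∧
      x = ∫ ω, |∑ j, a j * ξ n j ω| ∂(P n)} ∧
    sSup {x : ℝ | ∃ n : ℕ, 1 ≤ n ∧ ∃ a : Fin n → ℝ, ∑ j, a j ^ 2 = 1 ∧
      x = ∫ ω, |∑ j, a j * ξ n j ω| ∂(P n)} ≤
    1 - min (4 * p ^ 3 * (1 - p) ^ 3) ((2 * p - 1) ^ 4 * p * (1 - p))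
        / (45 - 3 * (p * (1 - p)) ^ 3) := by
  have hle : ∀ x ∈ {x : ℝ | ∃ n : ℕ, 1 ≤ n ∧ ∃ a : Fin n → ℝ, ∑ j, a j ^ 2 = 1 ∧
      x = ∫ ω, |∑ j, a j * ξ n j ω| ∂(P n)},
      x ≤ 1 - min (4 * p ^ 3 * (1 - p) ^ 3) ((2 * p - 1) ^ 4 * p * (1 - p))
        / (45 - 3 * (p * (1 - p)) ^ 3) := by
    rintro x ⟨n, -, a, ha, rfl⟩
    exact integral_abs_sum_biasedBernoulli_le hp (hlaw n) (hindep n) ha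
  exact ⟨fun n _ a _ => integrable_abs_sum_biasedBernoulli (hlaw n) a, ⟨_, hle⟩,
    csSup_le ⟨_, 1, le_rfl, fun _ => 1, by simp, rfl⟩ hle⟩
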